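/- Let $\mathrm{Diff}_1$ be the set of germs of diffeomorphisms of $(\mathbb C^2,0)$ tangent to the identity, i.e. of pairs of convergent power series $$\Phi=(\phi,\psi)=\Big(x+\sum_{i+j>1}a_{ij}x^iy^j,\ y+\sum_{i+j>1}b_{ij}x^iy^j\Big)\in\mathbb C\{x,y\}^2 .$$ For a pair $F$ of formal power series in $x,y$ let $J^NF$ be its jet of order $N$ (all terms of total degree $i+j\le N$), and let $\Vert F\Vert\in[0,+\infty]$ be the supremum of the absolute values of the coefficients of its two components. In $\mathbb P^1\times\mathbb P^1$ with affine coordinates $(x,y)$, let $D_1$ and $D_2$ be the closures of $\{y=0\}$ and $\{x=0\}$, let $V_i$ be a copy of the germ of neighborhood of $D_i$, and let $V_\Phi$ be the neighborhood germ of the bouquet $D_1\cup D_2$ obtained by gluing $V_2$ to $V_1$ at the origin by $\Phi:V_2\to V_1$. A formal foliation on $V_\Phi$ is defined by a pair of nonzero formal $1$-forms $\omega_i=P_i\,dx+Q_i\,dy$ ($i=1,2$) with $$P_1,Q_1\in\mathbb C[[y]][x],\qquad P_2,Q_2\in\mathbb C[[x]][y],\qquad \Phi^*\omega_1\wedge\omega_2=0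 .$$ **Theorem.** For any $\Phi\in\mathrm{Diff}_1$, $N_0\in\mathbb N$ and $\varepsilon>0$, there exists $\widehat\Phi\in\mathrm{Diff}_1$ such that 1. $J^{N_0}\Phi=J^{N_0}\widehat\Phi$; 2. $\Vert\Phi-\widehat\Phi\Vert<\varepsilon$; 3. $V_{\widehat\Phi}$ does not have any formal foliation. -/

import Mathlib

open scoped ENNReal

namespace Bouquet

noncomputable section

/-- Formal power series in two variables; the index `0` is the variable `x`, the index `1` is `y`. -/
abbrev Series := MvPowerSeries (Fin 2) ℂ

/-- `f ∈ ℂ{x,y}`: for some radius `r > 0` the series `∑ |a_ij| r^(i+j)` converges. -/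
def IsConvergent (f : Series) : Prop :=
  ∃ r : ℝ, 0 < r ∧
    Summable fun n : Fin 2 →₀ ℕ => ‖MvPowerSeries.coeff n f‖ * r ^ n.degree

/-- The group `Diff_1` of germs of diffeomorphisms of `(ℂ², 0)` tangent to the identity:
pairs `(φ, ψ) = (x + ⋯, y + ⋯)` of convergent power series, where the dots stand for terms
of total degree at least two. -/
structure DiffOne where
  comp : Fin 2 → Series
  convergent : ∀ i, IsConvergent (comp i)
  tangent : ∀ i, ∀ n : Fin 2 →₀ ℕ, n.degree ≤ 1 →
    MvPowerSeries.coeff n (comp i) = MvPowerSeries.coeff n (MvPowerSeries.X i : Series)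

/-- The jet of order `N`, i.e. the sum of all terms of total degree at most `N`
(`MvPowerSeries.truncTotal` keeps the degrees strictly below its argument). -/
def jet (N : ℕ) (f : Series) : MvPolynomial (Fin 2) ℂ :=
  MvPowerSeries.truncTotal (N + 1) f

/-- The jet of order `N` of a pair of power series. -/
def jetPair (N : ℕ) (F : Fin 2 → Series) : Fin 2 → MvPolynomial (Fin 2) ℂ :=
  fun i => jet N (F i)

/-- The sup-norm `sup |a_ij|` on coefficients, with values in `[0, ∞]`. -/
def coeffNorm (f : Series) : ℝ≥0∞ :=
  ⨆ n : Fin 2 →₀ ℕ, ‖MvPowerSeries.coeff n f‖ₑ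

/-- The sup-norm on coefficients of a pair of power series. -/
def coeffNormPair (F : Fin 2 → Series) : ℝ≥0∞ :=
  ⨆ i : Fin 2, coeffNorm (F i)

/-- A formal `1`-form `P dx + Q dy` at the origin of `ℂ²`. -/
@[ext]
structure OneForm where
  P : Series
  Q : Series

/-- The coefficient of `dx ∧ dy` in `ω ∧ η`. -/
def OneForm.wedge (ω η : OneForm) : Series :=
  ω.P * η.Q - ω.Q * η.P

/-- The pull-back `Φ^* ω = P(φ,ψ) dφ + Q(φ,ψ) dψ` by `Φ = (φ, ψ)`. -/
def OneForm.pullback (Φ : DiffOne) (ω : OneForm) : OneForm where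
  P := MvPowerSeries.subst Φ.comp ω.P * MvPowerSeries.pderiv ℂ 0 (Φ.comp 0) +
    MvPowerSeries.subst Φ.comp ω.Q * MvPowerSeries.pderiv ℂ 0 (Φ.comp 1)
  Q := MvPowerSeries.subst Φ.comp ω.P * MvPowerSeries.pderiv ℂ 1 (Φ.comp 0) +
    MvPowerSeries.subst Φ.comp ω.Q * MvPowerSeries.pderiv ℂ 1 (Φ.comp 1)

/-- `f` is polynomial in the `i`-th variable: the degrees in that variable of the monomials of `f`
are bounded. For `i = 0` these are the elements of `ℂ[[y]][x]`, for `i = 1` those of `ℂ[[x]][y]`. -/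
def IsPolynomialIn (i : Fin 2) (f : Series) : Prop :=
  ∃ k : ℕ, ∀ n : Fin 2 →₀ ℕ, MvPowerSeries.coeff n f ≠ 0 → n i ≤ k

/-- A formal (singular) foliation on the neighborhood `V_Φ` of the bouquet `D₁ ∪ D₂`, which is
glued from the two trivial neighborhoods `V_i` of `D₁ = {y = 0}` and `D₂ = {x = 0}` in `ℙ¹ × ℙ¹`
along `Φ : V₂ → V₁` at the origin. It is given by nontrivial `1`-forms `ω₁` on `V₁`, polynomial in
`x` and formal in `y`, and `ω₂` on `V₂`, polynomial in `y` and formal in `x`, whose kernels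
correspond under the gluing: `Φ^* ω₁ ∧ ω₂ = 0`. The forms are not required to be free of
common factors; dividing these out does not change the foliation. -/
structure FormalFoliation (Φ : DiffOne) where
  ω₁ : OneForm
  ω₂ : OneForm
  nontrivial₁ : ω₁.P ≠ 0 ∨ ω₁.Q ≠ 0
  nontrivial₂ : ω₂.P ≠ 0 ∨ ω₂.Q ≠ 0
  polynomial₁ : IsPolynomialIn 0 ω₁.P ∧ IsPolynomialIn 0 ω₁.Q
  polynomial₂ : IsPolynomialIn 1 ω₂.P ∧ IsPolynomialIn 1 ω₂.Q
  compatible : (ω₁.pullback Φ).wedge ω₂ = 0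

end

end Bouquet

/-! Perturb the coefficients of `Φ` in high degree by small numbers that are algebraically
independent over the field generated by the coefficients of `Φ`. Each perturbed coefficient can then
be differentiated alone: some derivation `D` of `ℂ` sends it to `1` and kills all the others
(`exists_small_dual_derivations`).

Suppose the perturbed gluing had a foliation `(ω₁, ω₂)`. Applying `D` coefficientwise to `Φ^*ω₁ ∧ ω₂
= 0` (`linearized_relation`) gives, for each monomial of high degree, an identity whose left side is
a fixed nonzero first-order operator applied to that monomial. The right side is linear in the four
series obtained by applying `D` to the coefficients of `ω₁` and `ω₂`. These are unknown, but keep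
the degree bound in `x` or `y`.

Truncated at order `N`, the right sides lie in a space of dimension `O(N)` (`exists_finset_span`),
whereas the left sides have rank growing like `N²` (`exists_linearIndependent_truncTotal`). For
large `N` this is a contradiction. -/

namespace Bouquet

noncomputable section

/-! ### Derivations of `ℂ` dual to small transcendental numbers -/

open KaehlerDifferential in
/-- A derivation on a field of characteristic zero can be prescribed on a transcendence basis. -/
theorem exists_derivation_of_isTranscendenceBasis {K L ι : Type*} [Field K] [Field L] [CharZero K]
    [Algebra K L] {x : ι → L} (hx : IsTranscendenceBasis K x) (g : ι → L) :
    ∃ D : Derivation K L L, ∀ i, D (x i) = g i := by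
  let A := MvPolynomial ι K
  let : Algebra A L := (MvPolynomial.aeval x : A →ₐ[K] L).toRingHom.toAlgebra
  have : IsScalarTower K A L := IsScalarTower.of_algebraMap_eq fun r => by
    exact ((MvPolynomial.aeval x : A →ₐ[K] L).commutes r).symm
  have hmap : ∀ a : A, algebraMap A L a = MvPolynomial.aeval x a := fun _ => rfl
  have : FaithfulSMul A L := (faithfulSMul_iff_algebraMap_injective A L).2 hx.1
  let F := FractionRing A
  let : Algebra F L := FractionRing.liftAlgebra A L
  have : IsScalarTower A F L := FractionRing.isScalarTower_liftAlgebra A L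
  have : Algebra.IsAlgebraic A L := hx.isAlgebraic_iff.2 fun i => by
    rw [← MvPolynomial.aeval_X (R := K) x i, ← hmap]
    exact isAlgebraic_algebraMap _
  have : Algebra.IsAlgebraic F L := by
    exact (IsFractionRing.comap_isAlgebraic_iff (A := A) (K := F) (C := L)).1 inferInstance
  have : CharZero F := charZero_of_injective_algebraMap (R := K) (A := F) (algebraMap K F).injective
  -- Algebraic extensions in characteristic zero are separable, hence formally étale, and so are
  -- localizations. Therefore `Ω[L⁄K]` is the base change of `Ω[A⁄K]`, and a derivation of the
  -- polynomial ring extends to `L`.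
  have : Algebra.FormallyEtale F L := Algebra.FormallyEtale.of_isSeparable F L
  have : Algebra.FormallyEtale A F := Algebra.FormallyEtale.of_isLocalization (nonZeroDivisors A)
  have : Algebra.FormallyEtale A L := Algebra.FormallyEtale.comp A F L
  let d : Derivation K A L := MvPolynomial.mkDerivation K g
  let ℓ : Ω[L⁄K] →ₗ[L] L := (d.liftKaehlerDifferential.liftBaseChange L) ∘ₗ
    (tensorKaehlerEquivOfFormallyEtale K A L).symm.toLinearMap
  refine ⟨ℓ.compDer (KaehlerDifferential.D K L), fun i => ?_⟩
  have hxi : x i = algebraMap A L (MvPolynomial.X i) := by rw [hmap, MvPolynomial.aeval_X]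
  have h := tensorKaehlerEquivOfFormallyEtale_symm_D_algebraMap K A L (MvPolynomial.X i)
  rw [← hxi] at h
  change (d.liftKaehlerDifferential.liftBaseChange L)
    ((tensorKaehlerEquivOfFormallyEtale K A L).symm (KaehlerDifferential.D K L (x i))) = g i
  rw [h]
  rw [LinearMap.liftBaseChange_tmul, Derivation.liftKaehlerDifferential_comp_D, one_smul]
  exact MvPolynomial.mkDerivation_X K g i

open Cardinal in
/-- There are arbitrarily small complex numbers, indexed by any countable set, with respect to each
of which one can differentiate while keeping the others and a given countable set constant. -/
theorem exists_small_dual_derivations {ι : Type} [Countable ι] {S : Set ℂ} (hS : S.Countable)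
    {δ : ι → ℝ} (hδ : ∀ i, 0 < δ i) :
    ∃ t : ι → ℂ, (∀ i, ‖t i‖ ≤ δ i) ∧ ∀ i, ∃ D : Derivation ℤ ℂ ℂ,
      (∀ s ∈ S, D s = 0) ∧ D (t i) = 1 ∧ ∀ j, j ≠ i → D (t j) = 0 := by
  classical
  let K := Subfield.closure S
  have hK : #K ≤ ℵ₀ :=
    (Subfield.cardinalMk_closure_le_max S).trans (max_le (Cardinal.le_aleph0_iff_set_countable.2 hS) le_rfl)
  obtain ⟨κ, x, hx⟩ := exists_isTranscendenceBasis' K ℂ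
  -- `K` is countable, so a transcendence basis of `ℂ` over it has the cardinality of the continuum
  -- and has room for `ι`.
  have hκ : #ℂ = #κ :=
    IsAlgClosed.cardinal_eq_cardinal_transcendence_basis_of_aleph0_lt' x hx hK
      (by rw [Cardinal.mk_complex]; exact Cardinal.aleph0_lt_continuum)
  obtain ⟨e⟩ : Nonempty (ι ↪ κ) := by
    rw [← Cardinal.le_def, ← hκ, Cardinal.mk_complex]
    exact Cardinal.mk_le_aleph0.trans Cardinal.aleph0_lt_continuum.le
  have hq : ∀ i, ∃ n : ℕ, ‖x (e i)‖ ≤ n * δ i := fun i => by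
    obtain ⟨n, hn⟩ := exists_nat_ge (‖x (e i)‖ / δ i)
    exact ⟨n, (div_le_iff₀ (hδ i)).1 hn⟩
  choose q hq using hq
  -- Dividing by a positive integer makes the numbers small; derivations treat integers as
  -- constants, so it only rescales the dual values.
  refine ⟨fun i => x (e i) / (q i + 1 : ℕ), fun i => ?_, fun i => ?_⟩
  · rw [norm_div, Complex.norm_natCast, div_le_iff₀ (by positivity)]
    refine (hq i).trans ?_
    rw [mul_comm]
    gcongr
    · exact (hδ i).le
    · simp
  · obtain ⟨D, hD⟩ := exists_derivation_of_isTranscendenceBasis hx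
      (fun k => if k = e i then ((q i + 1 : ℕ) : ℂ) else 0)
    have hdiv : ∀ (z : ℂ) (n : ℕ), D (z / (n + 1 : ℕ)) = D z / (n + 1 : ℕ) := fun z n => by
      have h0 : ((n + 1 : ℕ) : ℂ) ≠ 0 := Nat.cast_ne_zero.2 n.succ_ne_zero
      rw [eq_div_iff h0]
      conv_rhs => rw [show z = ((n + 1 : ℕ) : ℂ) * (z / (n + 1 : ℕ)) by field_simp]
      rw [D.leibniz, Derivation.map_natCast]
      simp [mul_comm]
    refine ⟨D.restrictScalars ℤ, fun s hs => ?_, ?_, fun j hj => ?_⟩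
    · exact D.map_algebraMap (⟨s, Subfield.subset_closure hs⟩ : K)
    · have : ((q i + 1 : ℕ) : ℂ) ≠ 0 := Nat.cast_ne_zero.2 (q i).succ_ne_zero
      simp only [Derivation.restrictScalars_apply, hdiv, hD, if_true, div_self this]
    · simp only [Derivation.restrictScalars_apply, hdiv, hD, if_neg (e.injective.ne hj), zero_div]

end

end Bouquet

/-! ### Composition of power series and derivations of coefficients -/

namespace Bouquet

noncomputable section

open MvPowerSeries

/-- To check that an additive map takes a value in a subgroup, it suffices to look at finitely many
monomials, if the map vanishes on series of large order. -/
theorem apply_mem_of_monomial_mem {M : Type*} [AddCommGroup M] (V : AddSubgroup M)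
    (A : Series →+ M) (N : ℕ) (hA : ∀ f : Series, (N : ℕ∞) ≤ f.order → A f = 0) (f : Series)
    (hm : ∀ n : Fin 2 →₀ ℕ, n.degree < N → A (monomial n (coeff n f)) ∈ V) : A f ∈ V := by
  have h0 : A (f - (truncTotal N f : MvPolynomial (Fin 2) ℂ)) = 0 := by
    refine hA _ (nat_le_order fun d hd => ?_)
    rw [map_sub, MvPolynomial.coeff_coe, coeff_truncTotal _ hd, sub_self]
  rw [map_sub, sub_eq_zero] at h0
  rw [h0, MvPolynomial.as_sum (truncTotal N f)]
  have hcoe : ∀ (s : Finset (Fin 2 →₀ ℕ)) (g : (Fin 2 →₀ ℕ) → MvPolynomial (Fin 2) ℂ),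
      ((∑ n ∈ s, g n : MvPolynomial (Fin 2) ℂ) : Series) = ∑ n ∈ s, (g n : Series) :=
    fun s g => map_sum MvPolynomial.coeToMvPowerSeries.ringHom g s
  rw [hcoe, map_sum]
  refine V.sum_mem fun n hn => ?_
  have hdeg : n.degree < N := by
    by_contra h
    exact MvPolynomial.mem_support_iff.1 hn (coeff_truncTotal_eq_zero _ (not_lt.1 h))
  rw [MvPolynomial.coe_monomial, coeff_truncTotal _ hdeg]
  exact hm n hdeg

namespace DiffOne

variable (Φ : DiffOne)

theorem constantCoeff_comp (i : Fin 2) : constantCoeff (Φ.comp i) = 0 := by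
  rw [← coeff_zero_eq_constantCoeff_apply, Φ.tangent i 0 (by simp), coeff_zero_X]

theorem hasSubst : HasSubst Φ.comp :=
  hasSubst_of_constantCoeff_zero Φ.constantCoeff_comp

theorem one_le_order_comp (i : Fin 2) : 1 ≤ (Φ.comp i).order :=
  one_le_order_iff_constCoeff_eq_zero.2 (Φ.constantCoeff_comp i)

theorem order_le_order_subst (f : Series) : f.order ≤ (subst Φ.comp f).order := by
  refine le_trans ?_ (le_order_subst Φ.hasSubst f)
  calc f.order = 1 * f.order := (one_mul _).symm
    _ ≤ _ := mul_le_mul_left (le_iInf Φ.one_le_order_comp) _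

end DiffOne

section coeffDeriv

variable (D : Derivation ℤ ℂ ℂ)

/-- The derivation of the ring of power series acting on the coefficients. -/
def coeffDeriv : Derivation ℤ Series Series where
  toFun f := fun n => D (coeff n f)
  map_add' f g := by ext n; exact D.map_add _ _
  map_smul' c f := by ext n; exact D.map_smul c _
  map_one_eq_zero' := by
    ext n
    change D (coeff n 1) = 0
    rw [coeff_one]
    split_ifs <;> simp
  leibniz' f g := by
    ext n
    change D (coeff n (f * g)) = _
    rw [coeff_mul, map_sum]
    simp only [Derivation.leibniz, Finset.sum_add_distrib]
    simp only [smul_eq_mul, map_add]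
    congr 1
    · rw [coeff_mul]
      rfl
    · rw [mul_comm g, coeff_mul]
      exact Finset.sum_congr rfl fun _ _ => mul_comm _ _

@[simp]
theorem coeff_coeffDeriv (n : Fin 2 →₀ ℕ) (f : Series) :
    coeff n (coeffDeriv D f) = D (coeff n f) := rfl

theorem coeffDeriv_C (c : ℂ) : coeffDeriv D (C c) = C (D c) := by
  ext n
  rw [coeff_coeffDeriv, coeff_C, coeff_C]
  split_ifs <;> simp

theorem coeffDeriv_X (i : Fin 2) : coeffDeriv D (X i) = 0 := by
  ext n
  rw [coeff_coeffDeriv, coeff_X]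
  split_ifs <;> simp

theorem pderiv_coeffDeriv (i : Fin 2) (f : Series) :
    pderiv ℂ i (coeffDeriv D f) = coeffDeriv D (pderiv ℂ i f) := by
  ext n
  rw [coeff_coeffDeriv, coeff_pderiv, coeff_pderiv, coeff_coeffDeriv, D.leibniz]
  simp [mul_comm]

theorem order_le_order_coeffDeriv (f : Series) : f.order ≤ (coeffDeriv D f).order :=
  le_order fun d hd => by rw [coeff_coeffDeriv, coeff_of_lt_order hd, map_zero]

end coeffDeriv

theorem le_order_pderiv {N : ℕ} (i : Fin 2) {f : Series} (hf : ((N + 1 : ℕ) : ℕ∞) ≤ f.order) :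
    (N : ℕ∞) ≤ (pderiv ℂ i f).order :=
  nat_le_order fun d hd => by
    rw [coeff_pderiv, coeff_of_lt_order, zero_mul]
    refine lt_of_lt_of_le ?_ hf
    rw [map_add, Finsupp.degree_single]
    exact_mod_cast Nat.add_lt_add_right hd 1

/-- The chain rule for a derivation acting on the coefficients of a composition. -/
theorem coeffDeriv_subst (D : Derivation ℤ ℂ ℂ) (Φ : DiffOne) (f : Series) :
    coeffDeriv D (subst Φ.comp f) = subst Φ.comp (coeffDeriv D f) +
      ∑ i, subst Φ.comp (pderiv ℂ i f) * coeffDeriv D (Φ.comp i) := by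
  have hs := Φ.hasSubst
  -- The defect of the chain rule is itself a derivation along `subst Φ.comp`. It vanishes on
  -- constants and variables, hence on polynomials, and passes to series by continuity.
  let δ : Series →+ Series := AddMonoidHom.mk' (fun f => coeffDeriv D (subst Φ.comp f) -
    (subst Φ.comp (coeffDeriv D f) + ∑ i, subst Φ.comp (pderiv ℂ i f) * coeffDeriv D (Φ.comp i)))
    (fun f g => by
      simp only [map_add, subst_add hs, add_mul, Finset.sum_add_distrib]
      abel)
  have hδ : ∀ f, δ f = coeffDeriv D (subst Φ.comp f) - (subst Φ.comp (coeffDeriv D f) +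
    ∑ i, subst Φ.comp (pderiv ℂ i f) * coeffDeriv D (Φ.comp i)) := fun _ => rfl
  have hmul : ∀ f g, δ (f * g) = subst Φ.comp f * δ g + subst Φ.comp g * δ f := fun f g => by
    simp only [hδ, subst_mul hs, subst_add hs, Derivation.leibniz, smul_eq_mul, Fin.sum_univ_two]
    ring
  have hX : ∀ i, δ (X i) = 0 := fun i => by
    rw [hδ, subst_X hs, coeffDeriv_X, Finset.sum_eq_single i]
    · rw [pderiv_X_self, ← map_one C, subst_C, map_one, one_mul, ← map_zero C, subst_C, map_zero]
      simp
    · intro j _ hj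
      rw [pderiv_X_of_ne hj.symm, ← map_zero C, subst_C, map_zero, zero_mul]
    · simp
  have hC : ∀ c, δ (C c) = 0 := fun c => by
    rw [hδ, subst_C, coeffDeriv_C, subst_C]
    simp only [pderiv_C]
    rw [← map_zero C, subst_C, map_zero]
    simp
  have hpoly : ∀ p : MvPolynomial (Fin 2) ℂ, δ p = 0 := fun p => by
    induction p using MvPolynomial.induction_on with
    | C a => rw [MvPolynomial.coe_C, hC]
    | add p q hp hq => rw [MvPolynomial.coe_add, map_add, hp, hq, add_zero]
    | mul_X p i hp => rw [MvPolynomial.coe_mul, MvPolynomial.coe_X, hmul, hp, hX]; simp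
  rw [← sub_eq_zero, ← hδ]
  ext e
  -- The bound is `e.degree + 2` because `pderiv` lowers the order by one and the result must still
  -- have order above `e.degree`.
  refine AddSubgroup.mem_bot.1 (apply_mem_of_monomial_mem ⊥
    ((coeff e).toAddMonoidHom.comp δ) (e.degree + 2) (fun g hg => ?_) f fun n _ => ?_)
  · have hlt : (e.degree : ℕ∞) < ((e.degree + 1 : ℕ) : ℕ∞) := by exact_mod_cast Nat.lt_succ_self _
    have hg' : ((e.degree + 1 : ℕ) : ℕ∞) ≤ g.order :=
      le_trans (by exact_mod_cast Nat.le_succ _) hg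
    change coeff e (δ g) = 0
    rw [hδ, map_sub, map_add, map_sum, coeff_of_lt_order (f := coeffDeriv D _),
      coeff_of_lt_order (f := subst Φ.comp _), Finset.sum_eq_zero]
    · simp
    · intro i _
      refine coeff_of_lt_order (lt_of_lt_of_le (hlt.trans_le ?_) le_order_mul)
      exact le_add_right ((le_order_pderiv i hg).trans (Φ.order_le_order_subst _))
    · exact hlt.trans_le ((hg'.trans (order_le_order_coeffDeriv D _)).trans
        (Φ.order_le_order_subst _))
    · exact hlt.trans_le ((hg'.trans (Φ.order_le_order_subst _)).trans
        (order_le_order_coeffDeriv D _))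
  · change coeff e (δ _) ∈ _
    rw [← MvPolynomial.coe_monomial, hpoly]
    simp

/-- Tangency to the identity gives this for the variables; it passes to products by `uv - u'v' = u(v
- v') + (u - u')v'`. -/
theorem DiffOne.lt_order_subst_monomial_sub (Φ : DiffOne) (n : Fin 2 →₀ ℕ) :
    ((n.degree + 1 : ℕ) : ℕ∞) ≤
      (subst Φ.comp (monomial n 1 : Series) - monomial n 1).order := by
  have hs := Φ.hasSubst
  have hadd : ∀ n m : Fin 2 →₀ ℕ,
      ((n.degree + 1 : ℕ) : ℕ∞) ≤ (subst Φ.comp (monomial n 1 : Series) - monomial n 1).order →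
      ((m.degree + 1 : ℕ) : ℕ∞) ≤ (subst Φ.comp (monomial m 1 : Series) - monomial m 1).order →
      (((n + m).degree + 1 : ℕ) : ℕ∞) ≤
        (subst Φ.comp (monomial (n + m) 1 : Series) - monomial (n + m) 1).order := by
    intro n m hn hm
    have hord : ∀ k : Fin 2 →₀ ℕ, (k.degree : ℕ∞) ≤ (monomial k (1 : ℂ)).order := fun k => by
      rw [order_monomial_of_ne_zero one_ne_zero]
    have hmul : (monomial (n + m) 1 : Series) = monomial n 1 * monomial m 1 := by
      rw [monomial_mul_monomial, one_mul]
    have hsplit : subst Φ.comp (monomial (n + m) 1 : Series) - monomial (n + m) 1 =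
        subst Φ.comp (monomial n 1 : Series) * (subst Φ.comp (monomial m 1 : Series) - monomial m 1) +
        (subst Φ.comp (monomial n 1 : Series) - monomial n 1) * monomial m 1 := by
      rw [hmul, subst_mul hs]
      ring
    rw [hsplit, map_add]
    refine le_trans (le_min ?_ ?_) min_order_le_add
    · refine le_trans ?_ le_order_mul
      push_cast at hm ⊢
      rw [add_assoc]
      exact add_le_add ((hord n).trans (Φ.order_le_order_subst _)) hm
    · refine le_trans ?_ le_order_mul
      push_cast at hn ⊢
      rw [add_right_comm]
      exact add_le_add hn (hord m)
  have hzero : (((0 : Fin 2 →₀ ℕ).degree + 1 : ℕ) : ℕ∞) ≤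
      (subst Φ.comp (monomial 0 1 : Series) - monomial 0 1).order := by
    rw [monomial_zero_one, ← map_one C, subst_C, sub_self, order_zero]
    exact le_top
  induction n using Finsupp.induction_linear with
  | zero => exact hzero
  | add n m hn hm => exact hadd n m hn hm
  | single i k =>
    induction k with
    | zero => simpa using hzero
    | succ k ih =>
      rw [Finsupp.single_add]
      refine hadd _ _ ih ?_
      rw [← X_def, subst_X hs, Finsupp.degree_single]
      refine nat_le_order fun d hd => ?_
      rw [map_sub, Φ.tangent i d (by omega), sub_self]

/-- Composition with a diffeomorphism tangent to the identity preserves nonvanishing. -/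
theorem DiffOne.subst_ne_zero (Φ : DiffOne) {f : Series} (hf : f ≠ 0) : subst Φ.comp f ≠ 0 := by
  obtain ⟨d, hd, hdeg⟩ := exists_coeff_ne_zero_and_order (ne_zero_iff_order_finite.1 hf)
  let A : Series →ₗ[ℂ] ℂ :=
    coeff d ∘ₗ ((substAlgHom (R := ℂ) Φ.hasSubst).toLinearMap - LinearMap.id)
  have hA : ∀ g, A g = coeff d (subst Φ.comp g - g) := fun g => by simp [A]
  -- By minimality of the degree of `d`, only monomials of degree at least that of `d` occur in `f`,
  -- and composition alters each of them only in strictly higher degree. So the coefficient at `d`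
  -- is unchanged.
  have h0 : A f = 0 := by
    refine AddSubgroup.mem_bot.1 (apply_mem_of_monomial_mem ⊥ A.toAddMonoidHom (d.degree + 1)
      (fun g hg => ?_) f fun n hn => ?_)
    · have hlt : (d.degree : ℕ∞) < g.order :=
        lt_of_lt_of_le (by exact_mod_cast Nat.lt_succ_self _) hg
      change A g = 0
      rw [hA, map_sub, coeff_of_lt_order hlt,
        coeff_of_lt_order (hlt.trans_le (Φ.order_le_order_subst g)), sub_self]
    · change A _ = 0
      rcases Nat.lt_or_ge n.degree d.degree with h | h
      · rw [coeff_of_lt_order, map_zero, map_zero]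
        rw [← hdeg]
        exact_mod_cast h
      · have hlt : (d.degree : ℕ∞) < (subst Φ.comp (monomial n 1 : Series) - monomial n 1).order :=
          lt_of_lt_of_le (by exact_mod_cast Nat.lt_succ_of_le h) (Φ.lt_order_subst_monomial_sub n)
        rw [← mul_one (coeff n f), ← smul_eq_mul, map_smul, map_smul, hA, coeff_of_lt_order hlt,
          smul_zero]
  intro hs
  rw [hA, hs, map_sub, map_zero, zero_sub, neg_eq_zero] at h0
  exact hd h0

/-! ### Quadratic growth of rank -/

/-- Vectors with distinct leading exponents are linearly independent. -/
theorem linearIndependent_of_leading {ι V E : Type*} [AddCommGroup V] [Module ℂ V] [LinearOrder E]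
    {f : ι → V} (L : E → V →ₗ[ℂ] ℂ) {e : ι → E} (he : Function.Injective e)
    (hne : ∀ i, L (e i) (f i) ≠ 0) (hlt : ∀ i n, n < e i → L n (f i) = 0) :
    LinearIndependent ℂ f := by
  classical
  rw [linearIndependent_iff']
  intro s g hg
  by_contra! hcon
  obtain ⟨i₁, hi₁, hgi₁⟩ := hcon
  obtain ⟨i, hi, hmin⟩ := (s.filter fun i => g i ≠ 0).exists_min_image e
    ⟨i₁, Finset.mem_filter.2 ⟨hi₁, hgi₁⟩⟩
  rw [Finset.mem_filter] at hi
  have h := congrArg (L (e i)) hg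
  rw [map_zero, map_sum, Finset.sum_eq_single i, map_smul, smul_eq_mul] at h
  · exact mul_ne_zero hi.2 (hne i) h
  · intro j hj hji
    rw [map_smul, smul_eq_mul]
    by_cases hgj : g j = 0
    · rw [hgj, zero_mul]
    · rw [hlt j _ (lt_of_le_of_ne (hmin j (Finset.mem_filter.2 ⟨hj, hgj⟩))
        (he.ne hji.symm)), mul_zero]
  · exact fun h => absurd hi.1 h

/-- The images of the monomials under a nonzero differential operator of order one (multiplied by
`xy`) have rank growing quadratically with the order of truncation. -/
theorem exists_linearIndependent_truncTotal (a b c : Series) (h : a ≠ 0 ∨ b ≠ 0) :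
    ∃ κ : ℕ, ∀ s M : ℕ, ∃ m : Fin M × Fin M → (Fin 2 →₀ ℕ), (∀ p, s ≤ (m p).degree) ∧
      LinearIndependent ℂ fun p => truncTotal (2 * s + 4 * M + κ)
        (monomial (m p) 1 * ((m p 0 : ℂ) • a + (m p 1 : ℂ) • b + c) : Series) := by
  classical
  -- Let `d` be the lexicographically least exponent in `a`, `b` or `c`. The image of the monomial
  -- `m` then leads at `m + d`, with coefficient affine in `m`, provided this is nonzero.
  have hex : ∃ d : Lex (Fin 2 →₀ ℕ),
      ¬(coeff (ofLex d) a = 0 ∧ coeff (ofLex d) b = 0 ∧ coeff (ofLex d) c = 0) := by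
    by_contra! hcon
    rcases h with h | h
    · exact h (MvPowerSeries.ext fun d => (hcon (toLex d)).1)
    · exact h (MvPowerSeries.ext fun d => (hcon (toLex d)).2.1)
  obtain ⟨d, hd, hmin⟩ := WellFounded.has_min (wellFounded_lt (α := Lex (Fin 2 →₀ ℕ)))
    {d | ¬(coeff (ofLex d) a = 0 ∧ coeff (ofLex d) b = 0 ∧ coeff (ofLex d) c = 0)} hex
  have hmin' : ∀ n, n < d → coeff (ofLex n) a = 0 ∧ coeff (ofLex n) b = 0 ∧
      coeff (ofLex n) c = 0 := fun n hn => by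
    by_contra hcon
    exact hmin n hcon hn
  refine ⟨(ofLex d).degree, fun s M => ?_⟩
  -- A nonzero affine function cannot vanish at three corners of a 2×2 block, so each of the `M²`
  -- disjoint blocks contains a good exponent.
  have hgood : ∀ p : Fin M × Fin M, ∃ m : Fin 2 →₀ ℕ,
      (m 0 : ℂ) * coeff (ofLex d) a + (m 1 : ℂ) * coeff (ofLex d) b + coeff (ofLex d) c ≠ 0 ∧
      s + 2 * p.1 ≤ m 0 ∧ m 0 ≤ s + 2 * p.1 + 1 ∧ s + 2 * p.2 ≤ m 1 ∧ m 1 ≤ s + 2 * p.2 + 1 := by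
    intro p
    by_contra! hcon
    have key : ∀ u v : ℕ, u ≤ 1 → v ≤ 1 → ((s + 2 * p.1 + u : ℕ) : ℂ) * coeff (ofLex d) a +
        ((s + 2 * p.2 + v : ℕ) : ℂ) * coeff (ofLex d) b + coeff (ofLex d) c = 0 := by
      intro u v hu hv
      by_contra hne
      have := hcon (Finsupp.single 0 (s + 2 * p.1 + u) + Finsupp.single 1 (s + 2 * p.2 + v))
      simp only [Finsupp.add_apply, Finsupp.single_apply] at this
      simp only [if_true, Fin.isValue, one_ne_zero, zero_ne_one, if_false, add_zero, zero_add]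
        at this
      have := this hne (by omega) (by omega) (by omega)
      omega
    have h00 := key 0 0 (by omega) (by omega)
    have h10 := key 1 0 (by omega) (by omega)
    have h01 := key 0 1 (by omega) (by omega)
    push_cast at h00 h10 h01
    have ha : coeff (ofLex d) a = 0 := by linear_combination h10 - h00
    have hb : coeff (ofLex d) b = 0 := by linear_combination h01 - h00
    rw [ha, hb] at h00
    exact hd ⟨ha, hb, by linear_combination h00⟩
  choose m hm h0 h0' h1 h1' using hgood
  have hdegree : ∀ n : Fin 2 →₀ ℕ, n.degree = n 0 + n 1 := fun n => by
    rw [Finsupp.degree_eq_sum, Fin.sum_univ_two]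
  refine ⟨m, fun p => ?_, ?_⟩
  · have := h0 p
    rw [hdegree]
    omega
  · refine linearIndependent_of_leading (E := Lex (Fin 2 →₀ ℕ))
      (fun n => MvPolynomial.lcoeff ℂ (ofLex n)) (e := fun p => toLex (m p) + d) ?_ ?_ ?_
    · intro p q hpq
      have hmq : m p = m q := toLex.injective (add_right_cancel hpq)
      have e0 := h0 p; have e1 := h0' p; have e2 := h1 p; have e3 := h1' p
      rw [hmq] at e0 e1 e2 e3
      have f0 := h0 q; have f1 := h0' q; have f2 := h1 q; have f3 := h1' q
      exact Prod.ext (Fin.ext (by omega)) (Fin.ext (by omega))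
    · intro p
      change MvPolynomial.coeff (m p + ofLex d) _ ≠ 0
      have e1 := h0' p; have e3 := h1' p
      have := p.1.2; have := p.2.2
      rw [coeff_truncTotal, coeff_add_monomial_mul, one_mul]
      · simpa using hm p
      · rw [map_add, hdegree (m p)]
        omega
    · intro p n hn
      change MvPolynomial.coeff (ofLex n) _ = 0
      by_cases hN : (ofLex n).degree < 2 * s + 4 * M + (ofLex d).degree
      · rw [coeff_truncTotal _ hN, coeff_monomial_mul]
        split_ifs with hle
        · obtain ⟨k, hk⟩ := exists_add_of_le hle
          have hkd : toLex k < d := by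
            have : toLex (m p) + toLex k < toLex (m p) + d := by
              rwa [← toLex_add, ← hk]
            exact lt_of_add_lt_add_left this
          obtain ⟨ka, kb, kc⟩ := hmin' _ hkd
          rw [hk, add_tsub_cancel_left]
          simp only [ofLex_toLex] at ka kb kc
          simp [ka, kb, kc]
        · rfl
      · exact coeff_truncTotal_eq_zero _ (not_lt.1 hN)

/-! ### Linear growth of dimension -/

/-- The exponents of total degree less than `N` and of degree at most `k` in the `i`-th variable. -/
def boundedExponents (i : Fin 2) (k N : ℕ) : Finset (Fin 2 →₀ ℕ) :=
  (Finset.range (k + 1) ×ˢ Finset.range N).image fun p =>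
    Finsupp.single i p.1 + Finsupp.single (1 - i) p.2

theorem card_boundedExponents_le (i : Fin 2) (k N : ℕ) :
    (boundedExponents i k N).card ≤ (k + 1) * N :=
  Finset.card_image_le.trans (by simp)

theorem mem_boundedExponents {i : Fin 2} {k N : ℕ} {n : Fin 2 →₀ ℕ} (hk : n i ≤ k)
    (hN : n.degree < N) : n ∈ boundedExponents i k N := by
  refine Finset.mem_image.2 ⟨(n i, n (1 - i)), ?_, ?_⟩
  · rw [Finset.mem_product, Finset.mem_range, Finset.mem_range]
    exact ⟨Nat.lt_succ_of_le hk, (Finsupp.le_degree _ _).trans_lt hN⟩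
  · ext j
    fin_cases i <;> fin_cases j <;> simp

/-- A linear map vanishing on series of order at least `N` sends the series of degree at most `k` in
one variable to a space of dimension at most `(k + 1) N`. -/
theorem exists_finset_span {V : Type*} [AddCommGroup V] [Module ℂ V] (A : Series →ₗ[ℂ] V) (N : ℕ)
    (hA : ∀ f : Series, (N : ℕ∞) ≤ f.order → A f = 0) (i : Fin 2) (k : ℕ) :
    ∃ B : Finset V, B.card ≤ (k + 1) * N ∧ ∀ f : Series,
      (∀ n : Fin 2 →₀ ℕ, coeff n f ≠ 0 → n i ≤ k) → A f ∈ Submodule.span ℂ (B : Set V) := by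
  classical
  refine ⟨(boundedExponents i k N).image fun n => A (monomial n 1),
    Finset.card_image_le.trans (card_boundedExponents_le i k N), fun f hf => ?_⟩
  refine apply_mem_of_monomial_mem (Submodule.span ℂ _).toAddSubgroup A.toAddMonoidHom N hA f
    fun n hn => ?_
  change A _ ∈ Submodule.span ℂ _
  rw [← mul_one (coeff n f), ← smul_eq_mul, map_smul, map_smul]
  by_cases h : coeff n f = 0
  · rw [h, zero_smul]
    exact zero_mem _
  · refine Submodule.smul_mem _ _ (Submodule.subset_span ?_)
    exact Finset.mem_coe.2 (Finset.mem_image_of_mem _ (mem_boundedExponents (hf n h) hn))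

/-! ### The linearized relation and the dimension count -/

/-- The derivation `f ↦ S ∂f/∂x - R ∂f/∂y`, with kernel direction that of `R dx + S dy`. -/
def OneForm.field (ω : OneForm) (f : Series) : Series :=
  ω.Q * pderiv ℂ 0 f - ω.P * pderiv ℂ 1 f

theorem OneForm.wedge_pullback (Φ : DiffOne) (ω η : OneForm) :
    (ω.pullback Φ).wedge η = subst Φ.comp ω.P * η.field (Φ.comp 0) +
      subst Φ.comp ω.Q * η.field (Φ.comp 1) := by
  simp only [OneForm.wedge, OneForm.pullback, OneForm.field]
  ring

theorem X_mul_pderiv_monomial (i : Fin 2) (m : Fin 2 →₀ ℕ) :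
    X i * pderiv ℂ i (monomial m (1 : ℂ)) = (m i : ℂ) • monomial m (1 : ℂ) := by
  classical
  rw [← MvPolynomial.coe_monomial, pderiv_coe, ← MvPolynomial.coe_X, ← MvPolynomial.coe_mul,
    MvPolynomial.X_mul_pderiv_monomial, ← Nat.cast_smul_eq_nsmul ℂ, MvPolynomial.coe_smul]

/-- Used with `τ` the composition with `Φ` for the coefficients of `ω₁`, and with the identity for
those of `ω₂`. -/
theorem exists_finset_span_truncTotal_mul (τ : Series →ₐ[ℂ] Series)
    (hτ : ∀ f, f.order ≤ (τ f).order) (H : Series) (N : ℕ) (i : Fin 2) (k : ℕ) :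
    ∃ B : Finset (MvPolynomial (Fin 2) ℂ), B.card ≤ (k + 1) * N ∧ ∀ f : Series,
      (∀ n : Fin 2 →₀ ℕ, coeff n f ≠ 0 → n i ≤ k) →
        truncTotal N (H * τ f) ∈ Submodule.span ℂ (B : Set (MvPolynomial (Fin 2) ℂ)) := by
  refine exists_finset_span (truncTotal N ∘ₗ LinearMap.mulLeft ℂ H ∘ₗ τ.toLinearMap) N
    (fun f hf => ?_) i k
  ext n
  change MvPolynomial.coeff n (truncTotal N (H * τ f)) = _
  rw [MvPolynomial.coeff_zero]
  by_cases hn : n.degree < N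
  · rw [coeff_truncTotal _ hn]
    refine coeff_of_lt_order ?_
    calc (n.degree : ℕ∞) < N := by exact_mod_cast hn
      _ ≤ f.order := hf
      _ ≤ (τ f).order := hτ f
      _ ≤ H.order + (τ f).order := le_add_self
      _ ≤ _ := le_order_mul
  · exact coeff_truncTotal_eq_zero _ (not_lt.1 hn)

/-- The relation obtained by applying a derivation of the coefficients to `Φ^* ω ∧ η = 0`, when
only one component of `Φ` is affected by the derivation. -/
theorem linearized_relation (Φ : DiffOne) (w : Fin 2 → Series) (η : OneForm)
    (h : ∑ j, subst Φ.comp (w j) * η.field (Φ.comp j) = 0) (i : Fin 2) (D : Derivation ℤ ℂ ℂ)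
    (v : Series) (hi : coeffDeriv D (Φ.comp i) = v)
    (hne : ∀ j, j ≠ i → coeffDeriv D (Φ.comp j) = 0) :
    subst Φ.comp (w i) * η.field v +
        (∑ j, subst Φ.comp (pderiv ℂ i (w j)) * η.field (Φ.comp j)) * v =
      -(∑ j, η.field (Φ.comp j) * subst Φ.comp (coeffDeriv D (w j)) +
        (∑ j, subst Φ.comp (w j) * pderiv ℂ 0 (Φ.comp j)) * coeffDeriv D η.Q -
        (∑ j, subst Φ.comp (w j) * pderiv ℂ 1 (Φ.comp j)) * coeffDeriv D η.P) := by
  have hsub : ∀ f, coeffDeriv D (subst Φ.comp f) = subst Φ.comp (coeffDeriv D f) +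
      subst Φ.comp (pderiv ℂ i f) * v := fun f => by
    rw [coeffDeriv_subst, Finset.sum_eq_single i, hi]
    · intro j _ hj
      rw [hne j hj, mul_zero]
    · simp
  have hfield : ∀ f, coeffDeriv D (η.field f) = η.field (coeffDeriv D f) +
      (coeffDeriv D η.Q * pderiv ℂ 0 f - coeffDeriv D η.P * pderiv ℂ 1 f) := fun f => by
    simp only [OneForm.field, map_sub, Derivation.leibniz, smul_eq_mul, pderiv_coeffDeriv]
    ring
  have hsum : ∑ j, subst Φ.comp (w j) * η.field (coeffDeriv D (Φ.comp j)) =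
      subst Φ.comp (w i) * η.field v := by
    rw [Finset.sum_eq_single i, hi]
    · intro j _ hj
      simp [hne j hj, OneForm.field]
    · simp
  have hD := congrArg (coeffDeriv D) h
  rw [map_zero, map_sum] at hD
  simp only [Derivation.leibniz, smul_eq_mul, hsub, hfield] at hD
  rw [← hsum]
  simp only [Fin.sum_univ_two] at hD ⊢
  linear_combination hD

/-- If each coefficient of large degree of each component of `Φ` can be differentiated independently
of all the other coefficients of `Φ`, then `V_Φ` has no formal foliation. -/
theorem isEmpty_formalFoliation (Φ : DiffOne) (s : ℕ)
    (hD : ∀ (i : Fin 2) (m : Fin 2 →₀ ℕ), s ≤ m.degree → ∃ D : Derivation ℤ ℂ ℂ,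
      coeffDeriv D (Φ.comp i) = monomial m 1 ∧ ∀ j, j ≠ i → coeffDeriv D (Φ.comp j) = 0) :
    IsEmpty (FormalFoliation Φ) := by
  classical
  refine ⟨fun 𝓕 => ?_⟩
  obtain ⟨⟨k₁, hk₁⟩, ⟨k₂, hk₂⟩⟩ := 𝓕.polynomial₁
  obtain ⟨⟨k₃, hk₃⟩, ⟨k₄, hk₄⟩⟩ := 𝓕.polynomial₂
  let w : Fin 2 → Series := ![𝓕.ω₁.P, 𝓕.ω₁.Q]
  have hrel : ∑ j, subst Φ.comp (w j) * 𝓕.ω₂.field (Φ.comp j) = 0 := by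
    rw [Fin.sum_univ_two, ← 𝓕.compatible, OneForm.wedge_pullback]
    rfl
  -- Only the component `i` of `Φ` will be varied: `w i ≠ 0` makes the principal part of the
  -- operator nonzero.
  obtain ⟨i, hi⟩ : ∃ i, w i ≠ 0 := by
    rcases 𝓕.nontrivial₁ with h | h
    · exact ⟨0, h⟩
    · exact ⟨1, h⟩
  have hwi := Φ.subst_ne_zero hi
  have hX : ∀ j : Fin 2, (X j : Series) ≠ 0 := fun j h => by
    simpa [coeff_index_single_self_X] using congrArg (coeff (Finsupp.single j 1)) h
  -- Multiplying by `xy` turns the partial derivatives into Euler operators, which act on monomials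
  -- by scalars.
  let xy : Series := X 0 * X 1
  obtain ⟨κ, hκ⟩ := exists_linearIndependent_truncTotal
    (X 1 * (subst Φ.comp (w i) * 𝓕.ω₂.Q)) (-(X 0 * (subst Φ.comp (w i) * 𝓕.ω₂.P)))
    (xy * ∑ j, subst Φ.comp (pderiv ℂ i (w j)) * 𝓕.ω₂.field (Φ.comp j)) (by
      rcases 𝓕.nontrivial₂ with h | h
      · exact Or.inr (neg_ne_zero.2 (mul_ne_zero (hX 0) (mul_ne_zero hwi h)))
      · exact Or.inl (mul_ne_zero (hX 1) (mul_ne_zero hwi h)))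
  let k := k₁ + k₂ + k₃ + k₄
  -- Chosen so that `M² > 4(k + 1)N`, although `N` itself grows linearly with `M`.
  let M := 4 * (4 * (k + 1)) + 4 * (k + 1) * (2 * s + κ) + 1
  let N := 2 * s + 4 * M + κ
  obtain ⟨m, hms, hm⟩ := hκ s M
  let σ : Series →ₐ[ℂ] Series := substAlgHom Φ.hasSubst
  have hσ : ∀ f, σ f = subst Φ.comp f := substAlgHom_apply Φ.hasSubst
  have hσo : ∀ f, f.order ≤ (σ f).order := fun f => by
    rw [hσ]
    exact Φ.order_le_order_subst f
  obtain ⟨B₀, hB₀, hB₀'⟩ :=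
    exists_finset_span_truncTotal_mul σ hσo (xy * 𝓕.ω₂.field (Φ.comp 0)) N 0 k
  obtain ⟨B₁, hB₁, hB₁'⟩ :=
    exists_finset_span_truncTotal_mul σ hσo (xy * 𝓕.ω₂.field (Φ.comp 1)) N 0 k
  obtain ⟨B₂, hB₂, hB₂'⟩ :=
    exists_finset_span_truncTotal_mul (AlgHom.id ℂ Series) (fun _ => le_rfl)
      (xy * ∑ j, subst Φ.comp (w j) * pderiv ℂ 0 (Φ.comp j)) N 1 k
  obtain ⟨B₃, hB₃, hB₃'⟩ :=
    exists_finset_span_truncTotal_mul (AlgHom.id ℂ Series) (fun _ => le_rfl)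
      (xy * ∑ j, subst Φ.comp (w j) * pderiv ℂ 1 (Φ.comp j)) N 1 k
  let B := B₀ ∪ B₁ ∪ B₂ ∪ B₃
  let V := Submodule.span ℂ (B : Set (MvPolynomial (Fin 2) ℂ))
  have hmono : ∀ {B' : Finset (MvPolynomial (Fin 2) ℂ)} {g}, B' ⊆ B →
      g ∈ Submodule.span ℂ (B' : Set (MvPolynomial (Fin 2) ℂ)) → g ∈ V :=
    fun h hg => Submodule.span_mono (Finset.coe_subset.2 h) hg
  have hmem : ∀ p, truncTotal N (monomial (m p) 1 *
      ((m p 0 : ℂ) • (X 1 * (subst Φ.comp (w i) * 𝓕.ω₂.Q)) +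
        (m p 1 : ℂ) • (-(X 0 * (subst Φ.comp (w i) * 𝓕.ω₂.P))) +
        xy * ∑ j, subst Φ.comp (pderiv ℂ i (w j)) * 𝓕.ω₂.field (Φ.comp j)) : Series) ∈ V := by
    intro p
    obtain ⟨D, hDi, hDne⟩ := hD i (m p) (hms p)
    -- The crucial point: `D` acts on coefficients only, so it cannot enlarge supports. Hence `V`
    -- does not depend on `p` or on `D`.
    have hbound : ∀ (f : Series) (j : Fin 2) (l : ℕ), l ≤ k → (∀ n, coeff n f ≠ 0 → n j ≤ l) →
        ∀ n, coeff n (coeffDeriv D f) ≠ 0 → n j ≤ k := fun f j l hl hf n hn =>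
      (hf n fun h0 => hn (by rw [coeff_coeffDeriv, h0, map_zero])).trans hl
    have hlin := linearized_relation Φ w 𝓕.ω₂ hrel i D _ hDi hDne
    have e0 := X_mul_pderiv_monomial 0 (m p)
    have e1 := X_mul_pderiv_monomial 1 (m p)
    have heq : (monomial (m p) 1 * ((m p 0 : ℂ) • (X 1 * (subst Φ.comp (w i) * 𝓕.ω₂.Q)) +
        (m p 1 : ℂ) • (-(X 0 * (subst Φ.comp (w i) * 𝓕.ω₂.P))) +
        xy * ∑ j, subst Φ.comp (pderiv ℂ i (w j)) * 𝓕.ω₂.field (Φ.comp j)) : Series) =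
        -(xy * 𝓕.ω₂.field (Φ.comp 0) * σ (coeffDeriv D (w 0)) +
          xy * 𝓕.ω₂.field (Φ.comp 1) * σ (coeffDeriv D (w 1)) +
          (xy * ∑ j, subst Φ.comp (w j) * pderiv ℂ 0 (Φ.comp j)) * coeffDeriv D 𝓕.ω₂.Q -
          (xy * ∑ j, subst Φ.comp (w j) * pderiv ℂ 1 (Φ.comp j)) * coeffDeriv D 𝓕.ω₂.P) := by
      rw [Fin.sum_univ_two (f := fun j => 𝓕.ω₂.field (Φ.comp j) * _)] at hlin
      rw [hσ, hσ]
      rw [smul_eq_C_mul] at e0 e1 ⊢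
      rw [smul_eq_C_mul]
      have hf : 𝓕.ω₂.field (monomial (m p) 1) = 𝓕.ω₂.Q * pderiv ℂ 0 (monomial (m p) 1) -
        𝓕.ω₂.P * pderiv ℂ 1 (monomial (m p) 1) := rfl
      rw [hf] at hlin
      linear_combination xy * hlin - X 1 * (subst Φ.comp (w i) * 𝓕.ω₂.Q) * e0 +
        X 0 * (subst Φ.comp (w i) * 𝓕.ω₂.P) * e1
    rw [heq, map_neg, map_sub, map_add, map_add]
    refine V.neg_mem (V.sub_mem (V.add_mem (V.add_mem ?_ ?_) ?_) ?_)
    · exact hmono (by grind) (hB₀' _ (hbound _ 0 k₁ (by omega) hk₁))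
    · exact hmono (by grind) (hB₁' _ (hbound _ 0 k₂ (by omega) hk₂))
    · exact hmono (by grind) (hB₂' _ (hbound _ 1 k₄ (by omega) hk₄))
    · exact hmono (by grind) (hB₃' _ (hbound _ 1 k₃ (by omega) hk₃))
  have hcard : M * M ≤ B.card := by
    have h1 := finrank_span_eq_card hm
    rw [Fintype.card_prod, Fintype.card_fin] at h1
    rw [← h1]
    refine le_trans (Submodule.finrank_mono ?_) (finrank_span_finset_le_card B)
    rw [Submodule.span_le]
    rintro _ ⟨p, rfl⟩
    exact hmem p
  have hB : B.card ≤ 4 * ((k + 1) * N) := by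
    have u1 := Finset.card_union_le (B₀ ∪ B₁ ∪ B₂) B₃
    have u2 := Finset.card_union_le (B₀ ∪ B₁) B₂
    have u3 := Finset.card_union_le B₀ B₁
    change (B₀ ∪ B₁ ∪ B₂ ∪ B₃).card ≤ _
    omega
  have hfin := hcard.trans hB
  have hM : M = 4 * (4 * (k + 1)) + 4 * (k + 1) * (2 * s + κ) + 1 := rfl
  have hN : 4 * ((k + 1) * N) = 4 * (4 * (k + 1)) * M + 4 * (k + 1) * (2 * s + κ) := by
    change 4 * ((k + 1) * (2 * s + 4 * M + κ)) = _
    ring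
  rw [hN] at hfin
  have hMM : M * M = 4 * (4 * (k + 1)) * M + (4 * (k + 1) * (2 * s + κ) + 1) * M := by
    conv_lhs => rw [hM]
    ring
  rw [hMM] at hfin
  have hle := Nat.le_mul_of_pos_right (4 * (k + 1) * (2 * s + κ) + 1) (show 0 < M by omega)
  omega

/-! ### The perturbation -/

/-- Adding a small perturbation, supported in degrees at least `N + 2`, to the coefficients. -/
theorem DiffOne.exists_add (Φ : DiffOne) (N : ℕ) (t : Fin 2 → Series) (c : ℝ)
    (hsum : ∀ i, Summable fun n => ‖coeff n (t i)‖) (hc : ∀ i n, ‖coeff n (t i)‖ ≤ c)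
    (ht : ∀ i n, n.degree < N + 2 → coeff n (t i) = 0) :
    ∃ Ψ : DiffOne, Ψ.comp = Φ.comp + t ∧ jetPair N Φ.comp = jetPair N Ψ.comp ∧
      coeffNormPair (Φ.comp - Ψ.comp) ≤ ENNReal.ofReal c := by
  refine ⟨⟨Φ.comp + t, fun i => ?_, fun i n hn => ?_⟩, rfl, ?_, ?_⟩
  · obtain ⟨r, hr, hs⟩ := Φ.convergent i
    -- The perturbation is summable at radius `1`, so the sum converges absolutely at radius `min r
    -- 1`.
    have hr0 : 0 < min r 1 := lt_min hr one_pos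
    refine ⟨min r 1, hr0, Summable.of_nonneg_of_le (fun n => by positivity) (fun n => ?_)
      (hs.add (hsum i))⟩
    rw [Pi.add_apply, map_add]
    calc _ ≤ (‖coeff n (Φ.comp i)‖ + ‖coeff n (t i)‖) * min r 1 ^ n.degree := by
          gcongr
          exact norm_add_le _ _
      _ ≤ _ := by
          rw [add_mul]
          gcongr
          · exact min_le_left _ _
          · exact mul_le_of_le_one_right (norm_nonneg _)
              (pow_le_one₀ hr0.le (min_le_right _ _))
  · rw [Pi.add_apply, map_add, ht i n (by omega), add_zero, Φ.tangent i n hn]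
  · ext i n
    simp only [jetPair, jet]
    by_cases hn : n.degree < N + 1
    · rw [coeff_truncTotal _ hn, coeff_truncTotal _ hn, Pi.add_apply, map_add,
        ht i n (by omega), add_zero]
    · rw [coeff_truncTotal_eq_zero _ (not_lt.1 hn), coeff_truncTotal_eq_zero _ (not_lt.1 hn)]
  · refine iSup_le fun i => iSup_le fun n => ?_
    change ‖coeff n (Φ.comp i - (Φ.comp i + t i))‖ₑ ≤ _
    rw [sub_add_cancel_left, map_neg, enorm_neg, ← ofReal_norm]
    exact ENNReal.ofReal_le_ofReal (hc i n)

end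

end Bouquet

open MvPowerSeries in
theorem mainTheorem3 (Φ : Bouquet.DiffOne) (N₀ : ℕ) (ε : ℝ) (hε : 0 < ε) :
    ∃ Φhat : Bouquet.DiffOne,
      Bouquet.jetPair N₀ Φ.comp = Bouquet.jetPair N₀ Φhat.comp ∧
      Bouquet.coeffNormPair (Φ.comp - Φhat.comp) < ENNReal.ofReal ε ∧
      IsEmpty (Bouquet.FormalFoliation Φhat) := by
  classical
  -- A single summable family of bounds with total `C < ε` gives both convergence and the strict
  -- norm estimate.
  obtain ⟨δ, hδ, C, hC, hCε⟩ := NNReal.exists_pos_sum_of_countable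
    (Real.toNNReal_pos.2 hε).ne' (Fin 2 × (Fin 2 →₀ ℕ))
  obtain ⟨t, ht, hD⟩ := Bouquet.exists_small_dual_derivations (ι := Fin 2 × (Fin 2 →₀ ℕ))
    (S := Set.range fun p : Fin 2 × (Fin 2 →₀ ℕ) => coeff p.2 (Φ.comp p.1))
    (Set.countable_range _) (δ := fun p => δ p) (fun p => NNReal.coe_pos.2 (hδ p))
  -- Starting in degree `N₀ + 2` leaves the `N₀`-jet alone and, even for `N₀ = 0`, also the linear
  -- part.
  let r : Fin 2 → Bouquet.Series := fun i n => if N₀ + 2 ≤ n.degree then t (i, n) else 0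
  have hr : ∀ i n, coeff n (r i) = if N₀ + 2 ≤ n.degree then t (i, n) else 0 := fun _ _ => rfl
  have hrδ : ∀ i n, ‖coeff n (r i)‖ ≤ δ (i, n) := fun i n => by
    rw [hr]
    split_ifs
    · exact ht (i, n)
    · simp
  have hδs : Summable fun p => (δ p : ℝ) := NNReal.summable_coe.2 hC.summable
  obtain ⟨Φhat, hcomp, hjet, hnorm⟩ := Φ.exists_add N₀ r C
    (fun i => Summable.of_nonneg_of_le (fun _ => norm_nonneg _) (hrδ i)
      (hδs.comp_injective (Prod.mk_right_injective i)))
    (fun i n => (hrδ i n).trans (NNReal.coe_le_coe.2 (hC.tsum_eq ▸ hC.summable.le_tsum' (i, n))))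
    (fun i n hn => by rw [hr, if_neg (not_le.2 hn)])
  refine ⟨Φhat, hjet, hnorm.trans_lt ?_, ?_⟩
  · rw [ENNReal.ofReal_coe_nnreal]
    exact ENNReal.coe_lt_coe.2 hCε
  · refine Bouquet.isEmpty_formalFoliation Φhat (N₀ + 2) fun i m hm => ?_
    obtain ⟨D, hS, h1, h0⟩ := hD (i, m)
    have hcoeff : ∀ j n, coeff n (Bouquet.coeffDeriv D (Φhat.comp j)) =
        if N₀ + 2 ≤ n.degree then D (t (j, n)) else 0 := fun j n => by
      rw [Bouquet.coeff_coeffDeriv, hcomp, Pi.add_apply, map_add, map_add, hr,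
        hS _ ⟨(j, n), rfl⟩, zero_add]
      split_ifs <;> simp
    refine ⟨D, ?_, fun j hj => ?_⟩
    · ext n
      rw [hcoeff, coeff_monomial]
      by_cases hn : n = m
      · rw [if_pos hn, hn, if_pos hm, h1]
      · rw [if_neg hn, h0 (i, n) (by simpa using hn), ite_self]
    · ext n
      rw [hcoeff, h0 (j, n) (by simp [hj]), ite_self, map_zero]
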